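/- Let $\mu,\nu>0$. Let $\alpha_k,\beta_k,\gamma_k,\delta_k$ ($k=1,2,\dots$) be mutually independent random variables such that, for every $k$, $\alpha_k$ and $\delta_k$ are exponentially distributed with parameter (rate) $\mu$, and $\beta_k$ and $\gamma_k$ are exponentially distributed with parameter $\nu$. (This is the second-order exponential system whose entries $\alpha_k,\beta_k,\gamma_k,\delta_k$ have parameters $\mu,\nu,\sigma,\tau$, in the case $\tau=\mu$, $\sigma=\nu$.) Put $x(0)=y(0)=0$ and, for $k\ge 1$, $$x(k)=\max\bigl(x(k-1)+\alpha_k,\;y(k-1)+\beta_k\bigr),\qquad y(k)=\max\bigl(x(k-1)+\gamma_k,\;y(k-1)+\delta_k\bigr).$$ Then, almost surely, the Lyapunov exponent $$\lambda=\lim_{k\to\infty}\frac1k\max\bigl(x(k),y(k)\bigr)$$ exists and equals $$\lambda=\frac{P(\mu,\nu)}{Q(\mu,\nu)},$$ where \begin{align*} P(\mu,\nu)&=160\mu^{10}+1776\mu^{9}\nu+8220\mu^{8}\nu^{2}+21378\mu^{7}\nu^{3}+35595\mu^{6}\nu^{4}+41566\mu^{5}\nu^{5}\\ &\qquad+35595\mu^{4}\nu^{6}+21378\mu^{3}\nu^{7}+8220\mu^{2}\nu^{8}+1776\mu\nu^{9}+160\nu^{10},\\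 Q(\mu,\nu)&=16\mu\nu(\mu+\nu)\bigl(8\mu^{8}+80\mu^{7}\nu+321\mu^{6}\nu^{2}+690\mu^{5}\nu^{3}+880\mu^{4}\nu^{4}\\ &\qquad+690\mu^{3}\nu^{5}+321\mu^{2}\nu^{6}+80\mu\nu^{7}+8\nu^{8}\bigr). \end{align*} -/

import Mathlib

open MeasureTheory ProbabilityTheory Filter Topology

namespace MaxPlus

/-- The entries of the state transition matrices of a general second-order exponential system.
The variable `α k` is the entry `α_{k+1}` of the matrix `A(k+1)`, for `k = 0, 1, 2, …`, and
likewise for `β`, `γ`, `δ`. All entries of all matrices are mutually independent, and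
`α_k, β_k, γ_k, δ_k` are exponential with the rates `μ, ν, σ, τ`. -/
structure IsExponentialSystem {Ω : Type*} [MeasurableSpace Ω] (P : Measure Ω)
    (μ ν σ τ : ℝ) (α β γ δ : ℕ → Ω → ℝ) : Prop where
  law_α : ∀ k, HasLaw (α k) (expMeasure μ) P
  law_β : ∀ k, HasLaw (β k) (expMeasure ν) P
  law_γ : ∀ k, HasLaw (γ k) (expMeasure σ) P
  law_δ : ∀ k, HasLaw (δ k) (expMeasure τ) P
  indep : iIndepFun (fun (i : Fin 4 × ℕ) => (![α, β, γ, δ] i.1) i.2) P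

/-- The state vector `z(k) = (x(k), y(k))`: `z(0) = (0, 0)` and `z(k+1) = A(k+1) z(k)`, where the
product of the matrix with rows `(α, β)`, `(γ, δ)` and a vector is taken in the semiring with
the operations maximum and addition. -/
noncomputable def state {Ω : Type*} (α β γ δ : ℕ → Ω → ℝ) : ℕ → Ω → ℝ × ℝ
  | 0, _ => (0, 0)
  | k + 1, ω =>
    (max ((state α β γ δ k ω).1 + α k ω) ((state α β γ δ k ω).2 + β k ω),
     max ((state α β γ δ k ω).1 + γ k ω) ((state α β γ δ k ω).2 + δ k ω))

/-- `l` is the Lyapunov exponent of the system: `max (x(k), y(k)) / k` tends to `l` as `k → ∞`,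
almost surely. -/
def IsLyapunovExponent {Ω : Type*} [MeasurableSpace Ω] (P : Measure Ω)
    (α β γ δ : ℕ → Ω → ℝ) (l : ℝ) : Prop :=
  ∀ᵐ ω ∂P, Tendsto
    (fun k : ℕ => (1 / (k : ℝ)) * max (state α β γ δ k ω).1 (state α β γ δ k ω).2)
    atTop (𝓝 l)

/-- The numerator. -/
def numP (μ ν : ℝ) : ℝ :=
  160 * μ ^ 10 + 1776 * μ ^ 9 * ν + 8220 * μ ^ 8 * ν ^ 2 + 21378 * μ ^ 7 * ν ^ 3
    + 35595 * μ ^ 6 * ν ^ 4 + 41566 * μ ^ 5 * ν ^ 5 + 35595 * μ ^ 4 * ν ^ 6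
    + 21378 * μ ^ 3 * ν ^ 7 + 8220 * μ ^ 2 * ν ^ 8 + 1776 * μ * ν ^ 9 + 160 * ν ^ 10

/-- The denominator. -/
def denQ (μ ν : ℝ) : ℝ :=
  16 * μ * ν * (μ + ν) *
    (8 * μ ^ 8 + 80 * μ ^ 7 * ν + 321 * μ ^ 6 * ν ^ 2 + 690 * μ ^ 5 * ν ^ 3
      + 880 * μ ^ 4 * ν ^ 4 + 690 * μ ^ 3 * ν ^ 5 + 321 * μ ^ 2 * ν ^ 6 + 80 * μ * ν ^ 7
      + 8 * ν ^ 8)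

end MaxPlus

namespace MaxPlus

/-! ### Integrals against exponential laws -/

/-! The proof solves a Poisson equation: it exhibits V(x, y) = max(x, y) + h(|x − y|), with h
bounded, whose conditional mean grows by exactly λ = P/Q at each step. Then V(z(n)) − nλ is a
martingale with increments bounded in L², so V(z(n))/n → λ, and max(x(n), y(n))/n has the same limit
because h is bounded.

Such an h exists in closed form. If d = y − x ≥ 0, then after subtracting y the two new coordinates
are independent, each distributed as max(X − d, Y) with X, Y exponential of rates a, b. By
`maxLaw_add_smul` this law is the signed combination Exp(b) + e^(−ad) (Exp(a) − Exp(a+b)). The mean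
of V is bilinear in the two laws, hence a constant plus multiples of e^(−νd), e^(−μd), e^(−(μ+ν)d).
So h is sought in the span of these three exponentials. Matching coefficients gives three linear
equations, solved by `corrector`, and the constant left over is λ. The rational identities are the
`pairMean_...` lemmas; `integral_potential_step` is the resulting Poisson equation.

For the limit, orthogonality of increments gives second moments of order n
(`integral_centred_sq_le`). Summing along squares yields convergence there (`ae_tendsto_div_sq`),
and monotonicity of max(x(k), y(k)) fills the gaps. -/

lemma expMeasure_eq_withDensity (a : ℝ) :
    expMeasure a = volume.withDensity (exponentialPDF a) := rfl

lemma measurable_exponentialPDF (a : ℝ) : Measurable (exponentialPDF a) :=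
  (measurable_exponentialPDFReal a).ennreal_ofReal

lemma toReal_exponentialPDF_smul {a : ℝ} (ha : 0 < a) (f : ℝ → ℝ) :
    (fun x => (exponentialPDF a x).toReal • f x)
      = (Set.Ici (0 : ℝ)).indicator fun x => a * Real.exp (-(a * x)) * f x := by
  funext x
  by_cases hx : 0 ≤ x
  · rw [exponentialPDF_of_nonneg hx, ENNReal.toReal_ofReal (by positivity),
      Set.indicator_of_mem (Set.mem_Ici.2 hx), smul_eq_mul]
  · rw [exponentialPDF_of_neg (not_le.1 hx), Set.indicator_of_notMem (by simpa using hx)]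
    simp

lemma integral_expMeasure {a : ℝ} (ha : 0 < a) (f : ℝ → ℝ) :
    ∫ x, f x ∂expMeasure a = ∫ x in Set.Ioi 0, a * Real.exp (-(a * x)) * f x := by
  rw [expMeasure_eq_withDensity, integral_withDensity_eq_integral_toReal_smul
    (measurable_exponentialPDF a) (ae_of_all _ fun _ => ENNReal.ofReal_lt_top),
    toReal_exponentialPDF_smul ha, integral_indicator measurableSet_Ici,
    integral_Ici_eq_integral_Ioi]

lemma integrable_expMeasure_iff {a : ℝ} (ha : 0 < a) (f : ℝ → ℝ) :
    Integrable f (expMeasure a)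
      ↔ IntegrableOn (fun x => a * Real.exp (-(a * x)) * f x) (Set.Ioi 0) := by
  rw [expMeasure_eq_withDensity, integrable_withDensity_iff_integrable_smul'
    (measurable_exponentialPDF a) (ae_of_all _ fun _ => ENNReal.ofReal_lt_top),
    toReal_exponentialPDF_smul ha, integrable_indicator_iff measurableSet_Ici,
    integrableOn_Ici_iff_integrableOn_Ioi]

lemma expMeasure_Iic {a : ℝ} (ha : 0 < a) (t : ℝ) :
    expMeasure a (Set.Iic t) = ENNReal.ofReal (if 0 ≤ t then 1 - Real.exp (-(a * t)) else 0) := by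
  rw [expMeasure_eq_withDensity, withDensity_apply _ measurableSet_Iic,
    lintegral_exponentialPDF_eq_antiDeriv ha]

instance nullSingletonClass_expMeasure (a : ℝ) : NullSingletonClass (expMeasure a) := by
  rw [expMeasure_eq_withDensity]; infer_instance

lemma ae_nonneg_expMeasure {a : ℝ} (ha : 0 < a) : ∀ᵐ x ∂expMeasure a, 0 ≤ x := by
  have h : expMeasure a (Set.Iic 0) = 0 := by simp [expMeasure_Iic ha]
  have h2 : ∀ᵐ x ∂expMeasure a, x ∉ Set.Iic (0 : ℝ) := measure_eq_zero_iff_ae_notMem.1 h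
  filter_upwards [h2] with x hx
  exact (not_le.1 hx).le

lemma memLp_id_expMeasure {a : ℝ} (ha : 0 < a) : MemLp (fun x : ℝ => x) 2 (expMeasure a) := by
  rw [memLp_two_iff_integrable_sq (by fun_prop), integrable_expMeasure_iff ha]
  have h := integrableOn_rpow_mul_exp_neg_mul_rpow (p := 1) (s := 2) (b := a) (by norm_num)
    one_pos ha
  refine IntegrableOn.congr_fun (h.const_mul a) (fun x _ => ?_) measurableSet_Ioi
  simp only [Real.rpow_one, Real.rpow_ofNat, neg_mul]
  ring

lemma integrable_id_expMeasure {a : ℝ} (ha : 0 < a) : Integrable (fun x : ℝ => x) (expMeasure a) :=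
  have := isProbabilityMeasure_expMeasure ha
  (memLp_id_expMeasure ha).integrable (by norm_num)

lemma integral_id_expMeasure {a : ℝ} (ha : 0 < a) : ∫ x, x ∂expMeasure a = 1 / a := by
  have h := Real.integral_rpow_mul_exp_neg_mul_Ioi (a := 2) (r := a) (by norm_num) ha
  rw [integral_expMeasure ha]
  calc ∫ x in Set.Ioi 0, a * Real.exp (-(a * x)) * x
      = ∫ x in Set.Ioi 0, a * (x ^ ((2 : ℝ) - 1) * Real.exp (-(a * x))) := by
        refine setIntegral_congr_fun measurableSet_Ioi fun x _ => ?_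
        norm_num
        ring
    _ = 1 / a := by
        rw [integral_const_mul, h]
        norm_num
        field_simp

lemma integrable_exp_neg_expMeasure {a c : ℝ} (ha : 0 < a) (hc : 0 < c) :
    Integrable (fun x => Real.exp (-(c * x))) (expMeasure a) := by
  have := isProbabilityMeasure_expMeasure ha
  refine Integrable.mono' (integrable_const 1) (by fun_prop) ?_
  filter_upwards [ae_nonneg_expMeasure ha] with x hx
  rw [Real.norm_eq_abs, abs_of_pos (Real.exp_pos _), Real.exp_le_one_iff]
  nlinarith

lemma integral_exp_neg_expMeasure {a c : ℝ} (ha : 0 < a) (hc : 0 < c) :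
    ∫ x, Real.exp (-(c * x)) ∂expMeasure a = a / (a + c) := by
  rw [integral_expMeasure ha]
  calc ∫ x in Set.Ioi 0, a * Real.exp (-(a * x)) * Real.exp (-(c * x))
      = ∫ x in Set.Ioi 0, a * Real.exp (-(a + c) * x) := by
        refine setIntegral_congr_fun measurableSet_Ioi fun x _ => ?_
        simp only [mul_assoc, ← Real.exp_add]
        ring_nf
    _ = a / (a + c) := by
        rw [integral_const_mul, integral_exp_mul_Ioi (by linarith)]
        rw [mul_zero, Real.exp_zero, neg_div_neg_eq, mul_one_div]

/-- The memoryless property of the exponential law. -/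
lemma integral_indicator_Ioi_expMeasure {a t : ℝ} (ha : 0 < a) (ht : 0 ≤ t) (w : ℝ → ℝ) :
    ∫ s, (Set.Ioi t).indicator (fun s => w (s - t)) s ∂expMeasure a
      = Real.exp (-(a * t)) * ∫ x, w x ∂expMeasure a := by
  rw [integral_expMeasure ha, integral_expMeasure ha, ← integral_const_mul,
    ← integral_indicator measurableSet_Ioi, ← integral_indicator measurableSet_Ioi,
    ← integral_add_right_eq_self _ t]
  congr 1
  funext x
  by_cases hx : 0 < x
  · rw [Set.indicator_of_mem (by simp; linarith), Set.indicator_of_mem (by simpa using hx),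
      Set.indicator_of_mem (by simpa using hx), mul_add, neg_add, Real.exp_add]
    simp only [add_sub_cancel_right]
    ring
  · rw [Set.indicator_of_notMem (s := Set.Ioi 0) (a := x) (by simpa using hx)]
    by_cases hx' : x + t ∈ Set.Ioi (0 : ℝ)
    · rw [Set.indicator_of_mem hx', Set.indicator_of_notMem (by simpa using hx), mul_zero]
    · rw [Set.indicator_of_notMem hx']

lemma integral_indicator_Ici_expMeasure {a t : ℝ} (ha : 0 < a) (ht : 0 ≤ t) (w : ℝ → ℝ) :
    ∫ s, (Set.Ici t).indicator (fun s => w (s - t)) s ∂expMeasure a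
      = Real.exp (-(a * t)) * ∫ x, w x ∂expMeasure a := by
  rw [← integral_indicator_Ioi_expMeasure ha ht, integral_indicator measurableSet_Ici,
    integral_indicator measurableSet_Ioi, integral_Ici_eq_integral_Ioi]

lemma integrable_prod_of_abs_le {m₁ m₂ : Measure ℝ} [IsProbabilityMeasure m₁]
    [IsProbabilityMeasure m₂] (h₁ : Integrable (fun x : ℝ => x) m₁)
    (h₂ : Integrable (fun x : ℝ => x) m₂) {f : ℝ × ℝ → ℝ} (hf : Measurable f) {C : ℝ}
    (hC : ∀ z, |f z| ≤ |z.1| + |z.2| + C) : Integrable f (m₁.prod m₂) :=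
  Integrable.mono' (((h₁.comp_fst m₂).abs.add (h₂.comp_snd m₁).abs).add (integrable_const C))
    hf.aestronglyMeasurable (ae_of_all _ hC)

/-- The expectation of `max s t + h |s - t|` for independent exponential `s` and `t`. -/
lemma integral_integral_max_add {a b : ℝ} (ha : 0 < a) (hb : 0 < b) {h : ℝ → ℝ}
    (hm : Measurable h) {C : ℝ} (hC : ∀ r, 0 ≤ r → |h r| ≤ C) :
    ∫ t, ∫ s, (max s t + h |s - t|) ∂expMeasure a ∂expMeasure b
      = 1 / a + 1 / b - 1 / (a + b)
        + (b * ∫ x, h x ∂expMeasure a + a * ∫ x, h x ∂expMeasure b) / (a + b) := by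
  have := isProbabilityMeasure_expMeasure ha
  have := isProbabilityMeasure_expMeasure hb
  have hC0 : 0 ≤ C := (abs_nonneg _).trans (hC 0 le_rfl)
  have ia := integrable_id_expMeasure ha
  have ib := integrable_id_expMeasure hb
  have ih : Integrable h (expMeasure a) := by
    refine Integrable.mono' (integrable_const C) hm.aestronglyMeasurable ?_
    filter_upwards [ae_nonneg_expMeasure ha] with x hx using hC x hx
  -- With z = (t, s), the integrand is t + A + B: A is the contribution of the overshoot of s above
  -- t, B that of t above s, ties included. By memorylessness each overshoot is again exponential,
  -- so each term factors into a probability times a one-variable mean.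
  set A : ℝ × ℝ → ℝ := fun z => (Set.Ioi z.1).indicator (fun s => (s - z.1) + h (s - z.1)) z.2
    with hA
  set B : ℝ × ℝ → ℝ := fun z => (Set.Ici z.2).indicator (fun t => h (t - z.2)) z.1 with hB
  have mA : Measurable A := by
    have : A = {z : ℝ × ℝ | z.1 < z.2}.indicator fun z => (z.2 - z.1) + h (z.2 - z.1) := by
      funext z; simp [hA, Set.indicator]
    rw [this]
    exact Measurable.indicator (by fun_prop) (measurableSet_lt measurable_fst measurable_snd)
  have mB : Measurable B := by
    have : B = {z : ℝ × ℝ | z.2 ≤ z.1}.indicator fun z => h (z.1 - z.2) := by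
      funext z; simp [hB, Set.indicator]
    rw [this]
    exact Measurable.indicator (by fun_prop) (measurableSet_le measurable_snd measurable_fst)
  have iA : Integrable A ((expMeasure b).prod (expMeasure a)) := by
    refine integrable_prod_of_abs_le ib ia mA (C := C) fun z => ?_
    by_cases hz : z.2 ∈ Set.Ioi z.1
    · simp only [hA]
      rw [Set.indicator_of_mem hz]
      have h1 := hC (z.2 - z.1) (sub_nonneg.2 (le_of_lt hz))
      have h2 := abs_sub z.2 z.1
      have h3 := abs_add_le (z.2 - z.1) (h (z.2 - z.1))
      linarith
    · simp only [hA]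
      rw [Set.indicator_of_notMem hz]
      simp only [abs_zero]; positivity
  have iB : Integrable B ((expMeasure b).prod (expMeasure a)) := by
    refine integrable_prod_of_abs_le ib ia mB (C := C) fun z => ?_
    by_cases hz : z.1 ∈ Set.Ici z.2
    · simp only [hB]
      rw [Set.indicator_of_mem hz]
      have h1 := hC (z.1 - z.2) (sub_nonneg.2 hz)
      have h2 := abs_nonneg z.1
      have h3 := abs_nonneg z.2
      linarith
    · simp only [hB]
      rw [Set.indicator_of_notMem hz]
      simp only [abs_zero]; positivity
  have iAB : Integrable (fun z => A z + B z) ((expMeasure b).prod (expMeasure a)) := iA.add iB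
  have hH : ∀ t s, max s t + h |s - t| = (fun z : ℝ × ℝ => z.1 + (A z + B z)) (t, s) := by
    intro t s
    rcases lt_or_ge t s with hts | hts
    · simp only [hA, hB]
      rw [Set.indicator_of_mem (by exact hts), Set.indicator_of_notMem (by simpa using hts),
        max_eq_left hts.le, abs_of_pos (sub_pos.2 hts)]
      ring
    · simp only [hA, hB]
      rw [Set.indicator_of_notMem (by simpa using hts), Set.indicator_of_mem (by exact hts),
        max_eq_right hts, abs_of_nonpos (sub_nonpos.2 hts)]
      simp
  simp_rw [hH]
  rw [← integral_prod (fun z : ℝ × ℝ => z.1 + (A z + B z))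
    ((ib.comp_fst (expMeasure a)).add iAB),
    integral_add (ib.comp_fst (expMeasure a)) iAB, integral_add iA iB,
    integral_prod _ iA, integral_prod_symm _ iB, integral_fun_fst (fun x : ℝ => x)]
  have eA : ∫ t, ∫ s, A (t, s) ∂expMeasure a ∂expMeasure b
      = b / (b + a) * (1 / a + ∫ x, h x ∂expMeasure a) := by
    rw [← integral_exp_neg_expMeasure hb ha, ← integral_id_expMeasure ha, ← integral_add ia ih,
      ← integral_mul_const]
    refine integral_congr_ae ?_
    filter_upwards [ae_nonneg_expMeasure hb] with t ht
    exact integral_indicator_Ioi_expMeasure ha ht (fun r => r + h r)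
  have eB : ∫ s, ∫ t, B (t, s) ∂expMeasure b ∂expMeasure a
      = a / (a + b) * ∫ x, h x ∂expMeasure b := by
    rw [← integral_exp_neg_expMeasure ha hb, ← integral_mul_const]
    refine integral_congr_ae ?_
    filter_upwards [ae_nonneg_expMeasure ha] with s hs
    exact integral_indicator_Ici_expMeasure hb hs h
  rw [eA, eB, integral_id_expMeasure hb]
  simp
  field_simp
  ring

/-! ### The corrector and its algebra -/

/-- The numerator of the coefficient of `exp (-(μ * r))` in the corrector. -/
def corrNum (μ ν : ℝ) : ℝ :=
  64 * ν ^ 10 + 672 * μ * ν ^ 9 + 2872 * μ ^ 2 * ν ^ 8 + 6572 * μ ^ 3 * ν ^ 7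
    + 8786 * μ ^ 4 * ν ^ 6 + 6944 * μ ^ 5 * ν ^ 5 + 3118 * μ ^ 6 * ν ^ 4 + 716 * μ ^ 7 * ν ^ 3
    + 64 * μ ^ 8 * ν ^ 2

/-- The numerator of the coefficient of `exp (-((μ + ν) * r))` in the corrector. -/
def corrNumSum (μ ν : ℝ) : ℝ :=
  -(32 * μ ^ 2 * ν ^ 8 + 348 * μ ^ 3 * ν ^ 7 + 1254 * μ ^ 4 * ν ^ 6 + 1916 * μ ^ 5 * ν ^ 5
    + 1254 * μ ^ 6 * ν ^ 4 + 348 * μ ^ 7 * ν ^ 3 + 32 * μ ^ 8 * ν ^ 2)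

/-- The corrector: a bounded function `h` of `r = |y - x|` for which the conditional expectation of
`max (x(k+1), y(k+1)) + h |y(k+1) - x(k+1)|` given the state at time `k` is
`max (x(k), y(k)) + h |y(k) - x(k)|` plus a constant. -/
noncomputable def corrector (μ ν r : ℝ) : ℝ :=
  corrNum ν μ / denQ μ ν * Real.exp (-(ν * r)) + corrNum μ ν / denQ μ ν * Real.exp (-(μ * r))
    + corrNumSum μ ν / denQ μ ν * Real.exp (-((μ + ν) * r))

/-- The mean of the corrector under the exponential law of rate `a`. -/
noncomputable def corrMean (μ ν a : ℝ) : ℝ :=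
  corrNum ν μ / denQ μ ν * (a / (a + ν)) + corrNum μ ν / denQ μ ν * (a / (a + μ))
    + corrNumSum μ ν / denQ μ ν * (a / (a + (μ + ν)))

/-- The mean of `max s t + corrector |s - t|` for independent exponential `s` and `t` of rates `a`
and `b`. -/
noncomputable def pairMean (μ ν a b : ℝ) : ℝ :=
  1 / a + 1 / b - 1 / (a + b) + (b * corrMean μ ν a + a * corrMean μ ν b) / (a + b)

lemma denQ_pos {μ ν : ℝ} (hμ : 0 < μ) (hν : 0 < ν) : 0 < denQ μ ν := by
  unfold denQ; positivity

/-- The term free of d in the expansion of the expected potential; this is where the value of the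
exponent comes from. -/
lemma pairMean_rate_rate {μ ν : ℝ} (hμ : 0 < μ) (hν : 0 < ν) :
    pairMean μ ν μ ν = numP μ ν / denQ μ ν := by
  have hQ := (denQ_pos hμ hν).ne'
  unfold pairMean corrMean
  rw [eq_div_iff hQ]
  field_simp
  -- Denominators are cleared while these polynomials are still opaque; only the final polynomial
  -- identity needs them expanded.
  unfold corrNum corrNumSum denQ numP
  ring

/-- This and the next two lemmas are the linear system for the corrector: the coefficients of
e^(−νd), e^(−μd) and e^(−(μ+ν)d) produced by one step equal those of the corrector itself. -/
lemma pairMean_coeff_fst {μ ν : ℝ} (hμ : 0 < μ) (hν : 0 < ν) :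
    pairMean μ ν ν ν - pairMean μ ν (μ + ν) ν = corrNum ν μ / denQ μ ν := by
  have hQ := (denQ_pos hμ hν).ne'
  unfold pairMean corrMean
  rw [eq_div_iff hQ]
  field_simp
  unfold corrNum corrNumSum denQ
  ring

lemma pairMean_coeff_snd {μ ν : ℝ} (hμ : 0 < μ) (hν : 0 < ν) :
    pairMean μ ν μ μ - pairMean μ ν μ (μ + ν) = corrNum μ ν / denQ μ ν := by
  have hQ := (denQ_pos hμ hν).ne'
  unfold pairMean corrMean
  rw [eq_div_iff hQ]
  field_simp
  unfold corrNum corrNumSum denQ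
  ring

lemma pairMean_coeff_mul {μ ν : ℝ} (hμ : 0 < μ) (hν : 0 < ν) :
    pairMean μ ν ν μ - pairMean μ ν ν (μ + ν) - pairMean μ ν (μ + ν) μ
      + pairMean μ ν (μ + ν) (μ + ν) = corrNumSum μ ν / denQ μ ν := by
  have hQ := (denQ_pos hμ hν).ne'
  unfold pairMean corrMean
  rw [eq_div_iff hQ]
  field_simp
  unfold corrNum corrNumSum denQ
  ring

lemma measurable_corrector (μ ν : ℝ) : Measurable (corrector μ ν) := by
  unfold corrector; fun_prop

/-- A bound for the corrector. -/
noncomputable def corrBound (μ ν : ℝ) : ℝ :=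
  |corrNum ν μ / denQ μ ν| + |corrNum μ ν / denQ μ ν| + |corrNumSum μ ν / denQ μ ν|

lemma abs_mul_exp_neg_le (c : ℝ) {x : ℝ} (hx : 0 ≤ x) : |c * Real.exp (-x)| ≤ |c| := by
  rw [abs_mul, abs_of_pos (Real.exp_pos _)]
  exact mul_le_of_le_one_right (abs_nonneg _) (Real.exp_le_one_iff.2 (neg_nonpos.2 hx))

lemma abs_corrector_le {μ ν : ℝ} (hμ : 0 < μ) (hν : 0 < ν) (r : ℝ) (hr : 0 ≤ r) :
    |corrector μ ν r| ≤ corrBound μ ν := by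
  unfold corrector corrBound
  refine (abs_add_three _ _ _).trans ?_
  exact add_le_add_three (abs_mul_exp_neg_le _ (by positivity))
    (abs_mul_exp_neg_le _ (by positivity)) (abs_mul_exp_neg_le _ (by positivity))

lemma integral_corrector {μ ν a : ℝ} (hμ : 0 < μ) (hν : 0 < ν) (ha : 0 < a) :
    ∫ x, corrector μ ν x ∂expMeasure a = corrMean μ ν a := by
  have h1 := (integrable_exp_neg_expMeasure ha hν).const_mul (corrNum ν μ / denQ μ ν)
  have h2 := (integrable_exp_neg_expMeasure ha hμ).const_mul (corrNum μ ν / denQ μ ν)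
  have h3 := (integrable_exp_neg_expMeasure ha (add_pos hμ hν)).const_mul
    (corrNumSum μ ν / denQ μ ν)
  have h12 : Integrable (fun x => corrNum ν μ / denQ μ ν * Real.exp (-(ν * x))
    + corrNum μ ν / denQ μ ν * Real.exp (-(μ * x))) (expMeasure a) := h1.add h2
  unfold corrector corrMean
  rw [integral_add h12 h3, integral_add h1 h2, integral_const_mul, integral_const_mul,
    integral_const_mul, integral_exp_neg_expMeasure ha hν, integral_exp_neg_expMeasure ha hμ,
    integral_exp_neg_expMeasure ha (add_pos hμ hν)]

/-- The function `max s t + h |s - t|`, with `h` the corrector. -/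
noncomputable def potential (μ ν s t : ℝ) : ℝ := max s t + corrector μ ν |s - t|

lemma measurable_potential (μ ν : ℝ) :
    Measurable (fun z : ℝ × ℝ => potential μ ν z.1 z.2) := by
  have := measurable_corrector μ ν
  unfold potential
  fun_prop

lemma potential_comm (μ ν s t : ℝ) : potential μ ν s t = potential μ ν t s := by
  unfold potential
  rw [max_comm, abs_sub_comm]

lemma abs_max_le (s t : ℝ) : |max s t| ≤ |s| + |t| := by
  rcases max_choice s t with h | h <;> rw [h]
  · linarith [abs_nonneg t]
  · linarith [abs_nonneg s]

lemma abs_potential_le {μ ν : ℝ} (hμ : 0 < μ) (hν : 0 < ν) (s t : ℝ) :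
    |potential μ ν s t| ≤ |s| + |t| + corrBound μ ν := by
  refine (abs_add_le _ _).trans ?_
  gcongr
  · exact abs_max_le s t
  · exact abs_corrector_le hμ hν _ (abs_nonneg _)

lemma integral_integral_potential {μ ν a b : ℝ} (hμ : 0 < μ) (hν : 0 < ν) (ha : 0 < a)
    (hb : 0 < b) :
    ∫ t, ∫ s, potential μ ν s t ∂expMeasure a ∂expMeasure b = pairMean μ ν a b := by
  unfold potential pairMean
  rw [integral_integral_max_add ha hb (measurable_corrector μ ν) (abs_corrector_le hμ hν),
    integral_corrector hμ hν ha, integral_corrector hμ hν hb]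

/-! ### The law of the maximum of two exponential variables, one of them shifted -/

/-- The law of `max (X - d) Y` for independent exponential `X` and `Y` of rates `a` and `b`. -/
noncomputable def maxLaw (a b d : ℝ) : Measure ℝ :=
  ((expMeasure a).prod (expMeasure b)).map fun w => max (w.1 - d) w.2

lemma isProbabilityMeasure_maxLaw {a b : ℝ} (ha : 0 < a) (hb : 0 < b) (d : ℝ) :
    IsProbabilityMeasure (maxLaw a b d) := by
  have := isProbabilityMeasure_expMeasure ha
  have := isProbabilityMeasure_expMeasure hb
  exact Measure.isProbabilityMeasure_map (by fun_prop)

/-- The distribution function of the maximum is (1 − e^(−a(t+d)))(1 − e^(−bt)) for t ≥ 0; expanding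
the product gives the identity. The negative term is moved to the left so that only positive
measures occur. -/
lemma maxLaw_add_smul {a b d : ℝ} (ha : 0 < a) (hb : 0 < b) (hd : 0 ≤ d) :
    maxLaw a b d + ENNReal.ofReal (Real.exp (-(a * d))) • expMeasure (a + b)
      = expMeasure b + ENNReal.ofReal (Real.exp (-(a * d))) • expMeasure a := by
  have hab := add_pos ha hb
  have := isProbabilityMeasure_expMeasure ha
  have := isProbabilityMeasure_expMeasure hb
  have := isProbabilityMeasure_expMeasure hab
  have := isProbabilityMeasure_maxLaw ha hb d
  have hfin (m : Measure ℝ) [IsProbabilityMeasure m] :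
      IsFiniteMeasure (ENNReal.ofReal (Real.exp (-(a * d))) • m) :=
    Measure.smul_finite _ ENNReal.ofReal_ne_top
  have := hfin (expMeasure a)
  have := hfin (expMeasure (a + b))
  refine Measure.ext_of_Iic _ _ fun t => ?_
  have hU : maxLaw a b d (Set.Iic t)
      = expMeasure a (Set.Iic (t + d)) * expMeasure b (Set.Iic t) := by
    rw [maxLaw, Measure.map_apply (by fun_prop) measurableSet_Iic, ← Measure.prod_prod]
    congr 1
    ext w
    simp [Prod.le_def]
  simp only [Measure.add_apply, Measure.smul_apply, smul_eq_mul, hU, expMeasure_Iic ha,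
    expMeasure_Iic hb, expMeasure_Iic hab]
  by_cases ht : 0 ≤ t
  · have hle {c x : ℝ} (hc : 0 < c) (hx : 0 ≤ x) : 0 ≤ 1 - Real.exp (-(c * x)) :=
      sub_nonneg.2 (Real.exp_le_one_iff.2 (neg_nonpos.2 (by positivity)))
    have htd : 0 ≤ t + d := add_nonneg ht hd
    have e1 := hle ha htd
    have e2 := hle hb ht
    have e3 := hle hab ht
    have e4 := hle ha ht
    have e5 := (Real.exp_pos (-(a * d))).le
    simp only [if_pos ht, if_pos htd]
    rw [← ENNReal.ofReal_mul e1, ← ENNReal.ofReal_mul e5, ← ENNReal.ofReal_mul e5,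
      ← ENNReal.ofReal_add (mul_nonneg e1 e2) (mul_nonneg e5 e3),
      ← ENNReal.ofReal_add e2 (mul_nonneg e5 e4)]
    congr 1
    have h1 : Real.exp (-(a * (t + d))) = Real.exp (-(a * d)) * Real.exp (-(a * t)) := by
      rw [← Real.exp_add]; ring_nf
    have h2 : Real.exp (-((a + b) * t)) = Real.exp (-(a * t)) * Real.exp (-(b * t)) := by
      rw [← Real.exp_add]; ring_nf
    rw [h1, h2]
    ring
  · simp [if_neg ht]

/-- By `maxLaw_add_smul` the law is dominated by a positive combination of the two exponential laws.
-/
lemma integrable_maxLaw {a b d : ℝ} (ha : 0 < a) (hb : 0 < b) (hd : 0 ≤ d) {f : ℝ → ℝ}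
    (hfa : Integrable f (expMeasure a)) (hfb : Integrable f (expMeasure b)) :
    Integrable f (maxLaw a b d) := by
  refine Integrable.mono_measure (hfb.add_measure
    (hfa.smul_measure (c := ENNReal.ofReal (Real.exp (-(a * d)))) ENNReal.ofReal_ne_top)) ?_
  rw [← maxLaw_add_smul ha hb hd]
  exact Measure.le_add_right le_rfl

lemma integral_maxLaw {a b d : ℝ} (ha : 0 < a) (hb : 0 < b) (hd : 0 ≤ d) {f : ℝ → ℝ}
    (hfa : Integrable f (expMeasure a)) (hfb : Integrable f (expMeasure b))
    (hfab : Integrable f (expMeasure (a + b))) :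
    ∫ x, f x ∂maxLaw a b d = ∫ x, f x ∂expMeasure b
      + Real.exp (-(a * d)) * (∫ x, f x ∂expMeasure a - ∫ x, f x ∂expMeasure (a + b)) := by
  have h := congrArg (fun m => ∫ x, f x ∂m) (maxLaw_add_smul ha hb hd)
  rw [integral_add_measure (integrable_maxLaw ha hb hd hfa hfb)
      (hfab.smul_measure ENNReal.ofReal_ne_top),
    integral_add_measure hfb (hfa.smul_measure ENNReal.ofReal_ne_top), integral_smul_measure,
    integral_smul_measure, ENNReal.toReal_ofReal (Real.exp_pos _).le, smul_eq_mul,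
    smul_eq_mul] at h
  linarith

lemma integrable_potential {μ ν : ℝ} (hμ : 0 < μ) (hν : 0 < ν) {m₁ m₂ : Measure ℝ}
    [IsProbabilityMeasure m₁] [IsProbabilityMeasure m₂] (h₁ : Integrable (fun x : ℝ => x) m₁)
    (h₂ : Integrable (fun x : ℝ => x) m₂) :
    Integrable (fun z : ℝ × ℝ => potential μ ν z.2 z.1) (m₁.prod m₂) :=
  integrable_prod_of_abs_le h₁ h₂ ((measurable_potential μ ν).comp measurable_swap)
    (C := corrBound μ ν) fun z => (abs_potential_le hμ hν _ _).trans_eq (by ring)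

/-- The Poisson equation in terms of the distance `d` of the two coordinates. -/
lemma integral_integral_potential_maxLaw {μ ν d : ℝ} (hμ : 0 < μ) (hν : 0 < ν) (hd : 0 ≤ d) :
    ∫ t, ∫ s, potential μ ν s t ∂maxLaw ν μ d ∂maxLaw μ ν d
      = numP μ ν / denQ μ ν + corrector μ ν d := by
  have hs := add_pos hμ hν
  have inner (t a : ℝ) (ha : 0 < a) : Integrable (fun s => potential μ ν s t) (expMeasure a) := by
    have := isProbabilityMeasure_expMeasure ha
    refine Integrable.mono' (((integrable_id_expMeasure ha).abs.add (integrable_const |t|)).add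
      (integrable_const (corrBound μ ν))) ?_ (ae_of_all _ fun s => abs_potential_le hμ hν s t)
    exact ((measurable_potential μ ν).comp (measurable_prodMk_right (y := t))).aestronglyMeasurable
  have outer (a b : ℝ) (ha : 0 < a) (hb : 0 < b) :
      Integrable (fun t => ∫ s, potential μ ν s t ∂expMeasure a) (expMeasure b) := by
    have := isProbabilityMeasure_expMeasure ha
    have := isProbabilityMeasure_expMeasure hb
    exact (integrable_potential hμ hν (integrable_id_expMeasure hb)
      (integrable_id_expMeasure ha)).integral_prod_left
  have outerV (a : ℝ) (ha : 0 < a) :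
      Integrable (fun t => ∫ s, potential μ ν s t ∂expMeasure a) (maxLaw μ ν d) :=
    integrable_maxLaw hμ hν hd (outer a μ ha hμ) (outer a ν ha hν)
  have valueV (a : ℝ) (ha : 0 < a) :
      ∫ t, ∫ s, potential μ ν s t ∂expMeasure a ∂maxLaw μ ν d
        = pairMean μ ν a ν
          + Real.exp (-(μ * d)) * (pairMean μ ν a μ - pairMean μ ν a (μ + ν)) := by
    rw [integral_maxLaw hμ hν hd (outer a μ ha hμ) (outer a ν ha hν) (outer a _ ha hs),
      integral_integral_potential hμ hν ha hν, integral_integral_potential hμ hν ha hμ,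
      integral_integral_potential hμ hν ha hs]
  -- The signed expansion is applied to the inner law here and to the outer law in `valueV`;
  -- together they yield the four-term bilinear expansion.
  have hsplit (t : ℝ) : ∫ s, potential μ ν s t ∂maxLaw ν μ d
      = ∫ s, potential μ ν s t ∂expMeasure μ + Real.exp (-(ν * d))
        * (∫ s, potential μ ν s t ∂expMeasure ν - ∫ s, potential μ ν s t ∂expMeasure (μ + ν)) := by
    rw [integral_maxLaw hν hμ hd (inner t ν hν) (inner t μ hμ)
      (by rw [add_comm]; exact inner t _ hs), add_comm ν μ]
  have hsub : Integrable (fun t => ∫ s, potential μ ν s t ∂expMeasure ν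
      - ∫ s, potential μ ν s t ∂expMeasure (μ + ν)) (maxLaw μ ν d) :=
    (outerV ν hν).sub (outerV _ hs)
  simp_rw [hsplit]
  rw [integral_add (outerV μ hμ) (hsub.const_mul _),
    integral_const_mul, integral_sub (outerV ν hν) (outerV _ hs), valueV μ hμ, valueV ν hν,
    valueV _ hs, corrector, ← pairMean_rate_rate hμ hν, ← pairMean_coeff_fst hμ hν,
    ← pairMean_coeff_snd hμ hν, ← pairMean_coeff_mul hμ hν]
  have h2 : Real.exp (-((μ + ν) * d)) = Real.exp (-(μ * d)) * Real.exp (-(ν * d)) := by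
    rw [← Real.exp_add]; ring_nf
  rw [h2]
  ring

/-! ### One step of the system -/

/-- The image of the state `z` under the matrix with rows `w.1` and `w.2`. -/
noncomputable def step (z : ℝ × ℝ) (w : (ℝ × ℝ) × (ℝ × ℝ)) : ℝ × ℝ :=
  (max (z.1 + w.1.1) (z.2 + w.1.2), max (z.1 + w.2.1) (z.2 + w.2.2))

/-- The law of the matrix, given by its rows. -/
noncomputable def matrixLaw (μ ν : ℝ) : Measure ((ℝ × ℝ) × (ℝ × ℝ)) :=
  ((expMeasure μ).prod (expMeasure ν)).prod ((expMeasure ν).prod (expMeasure μ))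

lemma isProbabilityMeasure_matrixLaw {μ ν : ℝ} (hμ : 0 < μ) (hν : 0 < ν) :
    IsProbabilityMeasure (matrixLaw μ ν) := by
  have := isProbabilityMeasure_expMeasure hμ
  have := isProbabilityMeasure_expMeasure hν
  unfold matrixLaw
  infer_instance

lemma measurable_step : Measurable fun p : (ℝ × ℝ) × ((ℝ × ℝ) × (ℝ × ℝ)) => step p.1 p.2 := by
  unfold step
  fun_prop

lemma potential_add_left (μ ν c s t : ℝ) :
    potential μ ν (c + s) (c + t) = c + potential μ ν s t := by
  unfold potential
  rw [max_add_add_left, add_sub_add_left_eq_sub, add_assoc]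

/-- Translation by the larger coordinate `z.2` leaves only the gap d, and the two rows become
independent maxima with laws `maxLaw μ ν d` and `maxLaw ν μ d`. -/
lemma integral_potential_step_of_le {μ ν : ℝ} (hμ : 0 < μ) (hν : 0 < ν) {z : ℝ × ℝ}
    (hz : z.1 ≤ z.2) :
    ∫ w, potential μ ν (step z w).1 (step z w).2 ∂matrixLaw μ ν
      = potential μ ν z.1 z.2 + numP μ ν / denQ μ ν := by
  have := isProbabilityMeasure_expMeasure hμ
  have := isProbabilityMeasure_expMeasure hν
  have := isProbabilityMeasure_matrixLaw hμ hν
  set d := z.2 - z.1 with hdef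
  have hd : 0 ≤ d := sub_nonneg.2 hz
  have := isProbabilityMeasure_maxLaw hμ hν d
  have := isProbabilityMeasure_maxLaw hν hμ d
  set g : ℝ × ℝ → ℝ := fun w => max (w.1 - d) w.2 with hg
  have mg : Measurable g := by fun_prop
  have hmap : (matrixLaw μ ν).map (Prod.map g g) = (maxLaw μ ν d).prod (maxLaw ν μ d) :=
    (Measure.map_prod_map _ _ mg mg).symm
  have hstep (w : (ℝ × ℝ) × (ℝ × ℝ)) : potential μ ν (step z w).1 (step z w).2
      = z.2 + potential μ ν (Prod.map g g w).2 (Prod.map g g w).1 := by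
    rw [potential_comm μ ν (Prod.map g g w).2, ← potential_add_left]
    simp only [step, hg, Prod.map_fst, Prod.map_snd, ← max_add_add_left]
    congr 2 <;> rw [hdef] <;> ring
  have iV := integrable_maxLaw hμ hν hd (integrable_id_expMeasure hμ) (integrable_id_expMeasure hν)
  have iU := integrable_maxLaw hν hμ hd (integrable_id_expMeasure hν) (integrable_id_expMeasure hμ)
  have iP := integrable_potential hμ hν iV iU
  have iP' : Integrable (fun w => potential μ ν (Prod.map g g w).2 (Prod.map g g w).1)
      (matrixLaw μ ν) := by
    rw [← hmap] at iP
    exact iP.comp_measurable (mg.prodMap mg)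
  simp_rw [hstep]
  rw [integral_add (integrable_const _) iP', ← integral_map
    (f := fun p : ℝ × ℝ => potential μ ν p.2 p.1) (mg.prodMap mg).aemeasurable
    (by rw [hmap]; exact iP.aestronglyMeasurable), hmap, integral_prod _ iP,
    integral_integral_potential_maxLaw hμ hν hd, potential, max_eq_right hz, abs_sub_comm,
    abs_of_nonneg hd]
  simp
  ring

/-- Exchanging the two coordinates of the state preserves the law of the matrix. -/
lemma measurePreserving_matrixLaw_swap {μ ν : ℝ} (hμ : 0 < μ) (hν : 0 < ν) :
    MeasurePreserving (fun w : (ℝ × ℝ) × (ℝ × ℝ) => (w.2.swap, w.1.swap))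
      (matrixLaw μ ν) (matrixLaw μ ν) := by
  have := isProbabilityMeasure_expMeasure hμ
  have := isProbabilityMeasure_expMeasure hν
  have h1 : MeasurePreserving Prod.swap ((expMeasure μ).prod (expMeasure ν))
    ((expMeasure ν).prod (expMeasure μ)) := Measure.measurePreserving_swap
  have h2 : MeasurePreserving Prod.swap ((expMeasure ν).prod (expMeasure μ))
    ((expMeasure μ).prod (expMeasure ν)) := Measure.measurePreserving_swap
  exact Measure.measurePreserving_swap.comp (h1.prod h2)

/-- The Poisson equation. -/
lemma integral_potential_step {μ ν : ℝ} (hμ : 0 < μ) (hν : 0 < ν) (z : ℝ × ℝ) :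
    ∫ w, potential μ ν (step z w).1 (step z w).2 ∂matrixLaw μ ν
      = potential μ ν z.1 z.2 + numP μ ν / denQ μ ν := by
  rcases le_total z.1 z.2 with hz | hz
  · exact integral_potential_step_of_le hμ hν hz
  -- Reversing rows and columns sends (α, β, γ, δ) to (δ, γ, β, α). Equal rates on the diagonal and
  -- on the antidiagonal make this a symmetry of the law.
  · have h := integral_potential_step_of_le hμ hν (z := z.swap) hz
    have hm : Measurable fun w => potential μ ν (step z.swap w).1 (step z.swap w).2 :=
      (measurable_potential μ ν).comp (measurable_step.comp measurable_prodMk_left)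
    rw [← (measurePreserving_matrixLaw_swap hμ hν).map_eq,
      integral_map (measurePreserving_matrixLaw_swap hμ hν).measurable.aemeasurable
      hm.aestronglyMeasurable] at h
    rw [potential_comm μ ν z.1 z.2]
    refine Eq.trans (integral_congr_ae (ae_of_all _ fun w => ?_)) h
    simp only [step, Prod.fst_swap, Prod.snd_swap]
    rw [potential_comm, max_comm (z.1 + w.2.1), max_comm (z.1 + w.1.1)]

/-- The centred increment of the potential in one step. -/
noncomputable def increment (μ ν : ℝ) (z : ℝ × ℝ) (w : (ℝ × ℝ) × (ℝ × ℝ)) : ℝ :=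
  potential μ ν (step z w).1 (step z w).2 - potential μ ν z.1 z.2 - numP μ ν / denQ μ ν

/-- A bound for the increment, independent of the state. -/
noncomputable def incrementBound (μ ν : ℝ) (w : (ℝ × ℝ) × (ℝ × ℝ)) : ℝ :=
  |w.1.1| + |w.1.2| + |w.2.1| + |w.2.2| + (2 * corrBound μ ν + |numP μ ν / denQ μ ν|)

lemma measurable_increment (μ ν : ℝ) :
    Measurable fun p : (ℝ × ℝ) × ((ℝ × ℝ) × (ℝ × ℝ)) => increment μ ν p.1 p.2 := by
  unfold increment
  exact (((measurable_potential μ ν).comp measurable_step).sub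
    ((measurable_potential μ ν).comp measurable_fst)).sub_const _

/-- Every new coordinate is a maximum of old coordinates plus entries, which bounds the rise; the
larger old coordinate survives with its diagonal entry added, which bounds the fall. -/
lemma abs_max_step_sub_le (z : ℝ × ℝ) (w : (ℝ × ℝ) × (ℝ × ℝ)) :
    |max (step z w).1 (step z w).2 - max z.1 z.2|
      ≤ |w.1.1| + |w.1.2| + |w.2.1| + |w.2.2| := by
  have a1 := abs_le.1 (le_refl |w.1.1|)
  have a2 := abs_le.1 (le_refl |w.1.2|)
  have a3 := abs_le.1 (le_refl |w.2.1|)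
  have a4 := abs_le.1 (le_refl |w.2.2|)
  have b1 := le_max_left z.1 z.2
  have b2 := le_max_right z.1 z.2
  simp only [step]
  rw [abs_le]
  constructor
  · rcases le_total z.1 z.2 with hz | hz
    · rw [max_eq_right hz]
      have h1 := le_max_right (z.1 + w.2.1) (z.2 + w.2.2)
      have h2 := le_max_right (max (z.1 + w.1.1) (z.2 + w.1.2)) (max (z.1 + w.2.1) (z.2 + w.2.2))
      linarith
    · rw [max_eq_left hz]
      have h1 := le_max_left (z.1 + w.1.1) (z.2 + w.1.2)
      have h2 := le_max_left (max (z.1 + w.1.1) (z.2 + w.1.2)) (max (z.1 + w.2.1) (z.2 + w.2.2))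
      linarith
  · rw [sub_le_iff_le_add]
    refine max_le (max_le ?_ ?_) (max_le ?_ ?_) <;> linarith

lemma abs_increment_le {μ ν : ℝ} (hμ : 0 < μ) (hν : 0 < ν) (z : ℝ × ℝ)
    (w : (ℝ × ℝ) × (ℝ × ℝ)) : |increment μ ν z w| ≤ incrementBound μ ν w := by
  have h1 := abs_le.1 (abs_max_step_sub_le z w)
  have h2 := abs_le.1 (abs_corrector_le hμ hν |(step z w).1 - (step z w).2| (abs_nonneg _))
  have h3 := abs_le.1 (abs_corrector_le hμ hν |z.1 - z.2| (abs_nonneg _))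
  have h4 := abs_le.1 (le_refl |numP μ ν / denQ μ ν|)
  unfold increment incrementBound potential
  rw [abs_le]
  constructor <;> linarith

lemma memLp_incrementBound {μ ν : ℝ} (hμ : 0 < μ) (hν : 0 < ν) :
    MemLp (incrementBound μ ν) 2 (matrixLaw μ ν) := by
  have := isProbabilityMeasure_expMeasure hμ
  have := isProbabilityMeasure_expMeasure hν
  have := isProbabilityMeasure_matrixLaw hμ hν
  have hfst : MeasurePreserving Prod.fst (matrixLaw μ ν) _ := measurePreserving_fst
  have hsnd : MeasurePreserving Prod.snd (matrixLaw μ ν) _ := measurePreserving_snd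
  have h1 := (memLp_id_expMeasure hμ).comp_measurePreserving (measurePreserving_fst.comp hfst)
  have h2 := (memLp_id_expMeasure hν).comp_measurePreserving (measurePreserving_snd.comp hfst)
  have h3 := (memLp_id_expMeasure hν).comp_measurePreserving (measurePreserving_fst.comp hsnd)
  have h4 := (memLp_id_expMeasure hμ).comp_measurePreserving (measurePreserving_snd.comp hsnd)
  exact (((h1.abs.add h2.abs).add h3.abs).add h4.abs).add (memLp_const _)

lemma integral_increment {μ ν : ℝ} (hμ : 0 < μ) (hν : 0 < ν) (z : ℝ × ℝ) :
    ∫ w, increment μ ν z w ∂matrixLaw μ ν = 0 := by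
  have := isProbabilityMeasure_matrixLaw hμ hν
  have hi : Integrable (increment μ ν z) (matrixLaw μ ν) :=
    Integrable.mono' ((memLp_incrementBound hμ hν).integrable (by norm_num))
      ((measurable_increment μ ν).comp measurable_prodMk_left).aestronglyMeasurable
      (ae_of_all _ (abs_increment_le hμ hν z))
  have hc := integrable_const (μ := matrixLaw μ ν)
    (potential μ ν z.1 z.2 + numP μ ν / denQ μ ν)
  have h : ∫ w, (increment μ ν z w + (potential μ ν z.1 z.2 + numP μ ν / denQ μ ν)) ∂matrixLaw μ ν
      = potential μ ν z.1 z.2 + numP μ ν / denQ μ ν := by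
    refine Eq.trans (integral_congr_ae (ae_of_all _ fun w => ?_)) (integral_potential_step hμ hν z)
    simp only [increment]
    ring
  rw [integral_add hi hc] at h
  simpa using h

/-! ### Independence of the state and the next matrix -/

section Independence

variable {Ω : Type*} {μ ν : ℝ} {α β γ δ : ℕ → Ω → ℝ}

/-- The rows of the `k`-th matrix. -/
def matrixAt {Ω : Type*} (α β γ δ : ℕ → Ω → ℝ) (k : ℕ) (ω : Ω) : (ℝ × ℝ) × (ℝ × ℝ) :=
  ((α k ω, β k ω), (γ k ω, δ k ω))

lemma state_succ (k : ℕ) (ω : Ω) :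
    state α β γ δ (k + 1) ω = step (state α β γ δ k ω) (matrixAt α β γ δ k ω) := rfl

lemma measurable_state [MeasurableSpace Ω] (hα : ∀ k, Measurable (α k)) (hβ : ∀ k, Measurable (β k))
    (hγ : ∀ k, Measurable (γ k)) (hδ : ∀ k, Measurable (δ k)) (k : ℕ) :
    Measurable (state α β γ δ k) := by
  induction k with
  | zero => exact measurable_const
  | succ k ih =>
    have : Measurable (matrixAt α β γ δ k) :=
      ((hα k).prodMk (hβ k)).prodMk ((hγ k).prodMk (hδ k))
    exact measurable_step.comp (ih.prodMk this)

/-- Two sample spaces are allowed so that the recursion on `Ω` can be compared with the same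
recursion run on finite vectors of entries. -/
lemma state_eq_of_matrixAt_eq {Ω' : Type*} {α' β' γ' δ' : ℕ → Ω' → ℝ} {ω : Ω} {ω' : Ω'} {n : ℕ}
    (h : ∀ k < n, matrixAt α β γ δ k ω = matrixAt α' β' γ' δ' k ω') :
    state α β γ δ n ω = state α' β' γ' δ' n ω' := by
  induction n with
  | zero => rfl
  | succ n ih =>
    rw [state_succ, state_succ, ih fun k hk => h k (hk.trans n.lt_succ_self), h n n.lt_succ_self]

/-- The extension by zero of a family indexed by the entries of the first `n` matrices. -/
noncomputable def extendZero (n : ℕ) (v : ↥((Finset.univ : Finset (Fin 4)) ×ˢ Finset.range n) → ℝ)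
    (i : Fin 4 × ℕ) : ℝ :=
  if h : i ∈ (Finset.univ : Finset (Fin 4)) ×ˢ Finset.range n then v ⟨i, h⟩ else 0

lemma measurable_extendZero (n : ℕ) (i : Fin 4 × ℕ) :
    Measurable fun v => extendZero n v i := by
  unfold extendZero
  split_ifs with h
  · exact measurable_pi_apply _
  · exact measurable_const

lemma measurable_state_extendZero (n : ℕ) :
    Measurable (state (fun k v => extendZero n v (0, k)) (fun k v => extendZero n v (1, k))
      (fun k v => extendZero n v (2, k)) (fun k v => extendZero n v (3, k)) n) :=
  measurable_state (fun _ => measurable_extendZero _ _) (fun _ => measurable_extendZero _ _)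
    (fun _ => measurable_extendZero _ _) (fun _ => measurable_extendZero _ _) n

/-- Factors the state through the finitely many entries of index below n by a measurable map. This
gives a.e. measurability of the state from that of the entries, and lets independence of finite
blocks pass to it. -/
lemma state_eq_state_extendZero (n : ℕ) :
    state α β γ δ n = state (fun k v => extendZero n v (0, k)) (fun k v => extendZero n v (1, k))
      (fun k v => extendZero n v (2, k)) (fun k v => extendZero n v (3, k)) n
      ∘ fun ω (i : ↥((Finset.univ : Finset (Fin 4)) ×ˢ Finset.range n)) =>
        (![α, β, γ, δ] i.1.1) i.1.2 ω := by
  funext ω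
  refine state_eq_of_matrixAt_eq fun k hk => ?_
  simp [matrixAt, extendZero, hk]

variable [MeasurableSpace Ω] {P : Measure Ω}

lemma IsExponentialSystem.aemeasurable (hsys : IsExponentialSystem P μ ν ν μ α β γ δ)
    (i : Fin 4 × ℕ) : AEMeasurable ((![α, β, γ, δ] i.1) i.2) P := by
  obtain ⟨i, k⟩ := i
  fin_cases i
  · exact (hsys.law_α k).aemeasurable
  · exact (hsys.law_β k).aemeasurable
  · exact (hsys.law_γ k).aemeasurable
  · exact (hsys.law_δ k).aemeasurable

lemma IsExponentialSystem.aemeasurable_state (hsys : IsExponentialSystem P μ ν ν μ α β γ δ)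
    (n : ℕ) : AEMeasurable (state α β γ δ n) P := by
  rw [state_eq_state_extendZero]
  exact (measurable_state_extendZero n).comp_aemeasurable
    (aemeasurable_pi_lambda _ fun i => hsys.aemeasurable i.1)

lemma IsExponentialSystem.indepFun_state_matrixAt (hsys : IsExponentialSystem P μ ν ν μ α β γ δ)
    (n : ℕ) : IndepFun (state α β γ δ n) (matrixAt α β γ δ n) P := by
  have hdis : Disjoint ((Finset.univ : Finset (Fin 4)) ×ˢ Finset.range n)
      ((Finset.univ : Finset (Fin 4)) ×ˢ {n}) := by
    rw [Finset.disjoint_left]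
    rintro ⟨i, k⟩ h1 h2
    simp only [Finset.mem_product, Finset.mem_range, Finset.mem_singleton] at h1 h2
    omega
  have h := hsys.indep.indepFun_finset₀ _ _ hdis hsys.aemeasurable
  have hmem (i : Fin 4) : (i, n) ∈ (Finset.univ : Finset (Fin 4)) ×ˢ {n} := by simp
  let g : (↥((Finset.univ : Finset (Fin 4)) ×ˢ {n}) → ℝ) → (ℝ × ℝ) × (ℝ × ℝ) := fun v =>
    ((v ⟨(0, n), hmem 0⟩, v ⟨(1, n), hmem 1⟩), (v ⟨(2, n), hmem 2⟩, v ⟨(3, n), hmem 3⟩))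
  have hg : Measurable g := by fun_prop
  rw [state_eq_state_extendZero]
  exact h.comp (measurable_state_extendZero n) hg

variable [IsProbabilityMeasure P]

lemma IsExponentialSystem.hasLaw_matrixAt (hsys : IsExponentialSystem P μ ν ν μ α β γ δ) (k : ℕ) :
    HasLaw (matrixAt α β γ δ k) (matrixLaw μ ν) P := by
  have h1 : IndepFun (α k) (β k) P :=
    hsys.indep.indepFun (i := ((0 : Fin 4), k)) (j := ((1 : Fin 4), k)) (by simp)
  have h2 : IndepFun (γ k) (δ k) P :=
    hsys.indep.indepFun (i := ((2 : Fin 4), k)) (j := ((3 : Fin 4), k)) (by simp)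
  have h3 : IndepFun (fun ω => (α k ω, β k ω)) (fun ω => (γ k ω, δ k ω)) P :=
    hsys.indep.indepFun_prodMk_prodMk₀ hsys.aemeasurable ((0 : Fin 4), k) ((1 : Fin 4), k)
      ((2 : Fin 4), k) ((3 : Fin 4), k) (by simp) (by simp) (by simp) (by simp)
  exact h3.hasLaw_prod (h1.hasLaw_prod (hsys.law_α k) (hsys.law_β k))
    (h2.hasLaw_prod (hsys.law_γ k) (hsys.law_δ k))

/-- The product form replaces conditioning on the past: one integrates over the matrix with the
state frozen. -/
lemma IsExponentialSystem.hasLaw_state_matrixAt (hsys : IsExponentialSystem P μ ν ν μ α β γ δ)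
    (n : ℕ) : HasLaw (fun ω => (state α β γ δ n ω, matrixAt α β γ δ n ω))
      ((P.map (state α β γ δ n)).prod (matrixLaw μ ν)) P :=
  (hsys.indepFun_state_matrixAt n).hasLaw_prod ⟨hsys.aemeasurable_state n, rfl⟩
    (hsys.hasLaw_matrixAt n)

end Independence

/-! ### The law of large numbers -/

/-- The centred potential along the trajectory. -/
noncomputable def centred {Ω : Type*} (μ ν : ℝ) (α β γ δ : ℕ → Ω → ℝ) (n : ℕ) (ω : Ω) : ℝ :=
  potential μ ν (state α β γ δ n ω).1 (state α β γ δ n ω).2 - n * (numP μ ν / denQ μ ν)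

/-- The increments of the centred potential. -/
noncomputable def centredIncrement {Ω : Type*} (μ ν : ℝ) (α β γ δ : ℕ → Ω → ℝ) (n : ℕ) (ω : Ω) : ℝ :=
  increment μ ν (state α β γ δ n ω) (matrixAt α β γ δ n ω)

lemma centred_succ {Ω : Type*} {μ ν : ℝ} {α β γ δ : ℕ → Ω → ℝ} (n : ℕ) :
    centred μ ν α β γ δ (n + 1)
      = fun ω => centred μ ν α β γ δ n ω + centredIncrement μ ν α β γ δ n ω := by
  funext ω
  unfold centred centredIncrement increment
  rw [state_succ]
  push_cast
  ring

section LawOfLargeNumbers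

variable {Ω : Type*} [MeasurableSpace Ω] {P : Measure Ω} {μ ν : ℝ} {α β γ δ : ℕ → Ω → ℝ}

/-- Along squares the normalised second moments are O(1/n²), so the series of squared quotients has
finite mean, converges almost surely, and its terms tend to 0. -/
lemma ae_tendsto_div_sq {M : ℕ → Ω → ℝ} (hM : ∀ n, MemLp (M n) 2 P) {C : ℝ}
    (hC : ∀ n : ℕ, ∫ ω, M n ω ^ 2 ∂P ≤ C * (n + 1)) :
    ∀ᵐ ω ∂P, Tendsto (fun n : ℕ => M ((n + 1) ^ 2) ω / (((n + 1) ^ 2 : ℕ) : ℝ)) atTop (𝓝 0) := by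
  have hC0 : 0 ≤ C := by
    have h := (integral_nonneg fun ω => sq_nonneg (M 0 ω)).trans (hC 0)
    simpa using h
  set f : ℕ → Ω → ℝ := fun n ω => (M ((n + 1) ^ 2) ω / (((n + 1) ^ 2 : ℕ) : ℝ)) ^ 2 with hf
  have fint (n : ℕ) : Integrable (f n) P := by
    simp only [hf, div_pow]
    exact (hM _).integrable_sq.div_const _
  have fbound (n : ℕ) : ∫ ω, f n ω ∂P ≤ 2 * C * (1 / ((n : ℝ) + 1) ^ 2) := by
    simp only [hf, div_pow]
    rw [integral_div, div_le_iff₀ (by positivity)]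
    refine (hC _).trans ?_
    push_cast
    -- The factor 2 in `fbound` absorbs the extra 1: m² + 1 ≤ 2m² for m = n + 1.
    have h1 : (1 : ℝ) ≤ ((n : ℝ) + 1) ^ 2 := one_le_pow₀ (by linarith [n.cast_nonneg (α := ℝ)])
    have h2 : 2 * C * (1 / ((n : ℝ) + 1) ^ 2) * (((n : ℝ) + 1) ^ 2) ^ 2
        = C * (2 * ((n : ℝ) + 1) ^ 2) := by field_simp
    rw [h2]
    gcongr
    linarith
  have hsum : Summable fun n : ℕ => 2 * C * (1 / ((n : ℝ) + 1) ^ 2) := by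
    have h := (summable_nat_add_iff 1).2 (Real.summable_one_div_nat_pow.2 one_lt_two)
    push_cast at h
    exact h.mul_left _
  have hfin : ∫⁻ ω, ∑' n, ENNReal.ofReal (f n ω) ∂P ≠ ⊤ := by
    rw [lintegral_tsum fun n => (fint n).aestronglyMeasurable.aemeasurable.ennreal_ofReal]
    refine ne_top_of_le_ne_top hsum.tsum_ofReal_ne_top (ENNReal.tsum_le_tsum fun n => ?_)
    rw [← ofReal_integral_eq_lintegral_ofReal (fint n) (ae_of_all _ fun ω => sq_nonneg _)]
    exact ENNReal.ofReal_le_ofReal (fbound n)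
  have hae := ae_lt_top' (AEMeasurable.tsum
    fun n => (fint n).aestronglyMeasurable.aemeasurable.ennreal_ofReal) hfin
  filter_upwards [hae] with ω hω
  have h0 := ENNReal.tendsto_atTop_zero_of_tsum_ne_top hω.ne
  have h1 : Tendsto (fun n => f n ω) atTop (𝓝 0) := by
    have h := (ENNReal.tendsto_toReal ENNReal.zero_ne_top).comp h0
    refine Tendsto.congr (fun n => ?_) h
    exact ENNReal.toReal_ofReal (sq_nonneg _)
  have h2 := h1.sqrt
  rw [Real.sqrt_zero] at h2
  refine (tendsto_zero_iff_abs_tendsto_zero _).2 (Tendsto.congr (fun n => ?_) h2)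
  exact Real.sqrt_sq_eq_abs _

lemma tendsto_one_div_mul_of_monotone {u : ℕ → ℝ} {l : ℝ} (hu : Monotone u)
    (h : Tendsto (fun n : ℕ => u ((n + 1) ^ 2) / (((n + 1) ^ 2 : ℕ) : ℝ)) atTop (𝓝 l)) :
    Tendsto (fun k : ℕ => (1 / (k : ℝ)) * u k) atTop (𝓝 l) := by
  have hdiv : Tendsto (fun k : ℕ => u k / k) atTop (𝓝 l) := by
    refine tendsto_div_of_monotone_of_exists_subseq_tendsto_div u l hu fun a ha =>
      ⟨fun n => (n + 1) ^ 2, ?_, ?_, h⟩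
    -- Ratios of consecutive squares tend to 1, so this one subsequence serves every a > 1.
    · have hlim : Tendsto (fun n : ℕ => (1 + 1 / ((n : ℝ) + 1)) ^ 2) atTop (𝓝 1) := by
        simpa using ((tendsto_one_div_add_atTop_nhds_zero_nat (𝕜 := ℝ)).const_add 1).pow 2
      filter_upwards [hlim.eventually_lt_const ha] with n hn
      have hpos : (0 : ℝ) < (n : ℝ) + 1 := by positivity
      push_cast
      calc ((n : ℝ) + 1 + 1) ^ 2 = (1 + 1 / ((n : ℝ) + 1)) ^ 2 * ((n : ℝ) + 1) ^ 2 := by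
            field_simp
        _ ≤ a * ((n : ℝ) + 1) ^ 2 := by gcongr
    · refine tendsto_atTop_mono (fun n => ?_) tendsto_id
      simp only [id]
      nlinarith
  refine hdiv.congr fun k => ?_
  rw [one_div_mul_eq_div]

/-- The diagonal entries are almost surely nonnegative, so each coordinate is nondecreasing. -/
lemma IsExponentialSystem.ae_monotone_max (hsys : IsExponentialSystem P μ ν ν μ α β γ δ)
    (hμ : 0 < μ) :
    ∀ᵐ ω ∂P, Monotone fun k => max (state α β γ δ k ω).1 (state α β γ δ k ω).2 := by
  have hα : ∀ᵐ ω ∂P, ∀ k, 0 ≤ α k ω := ae_all_iff.2 fun k =>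
    ((hsys.law_α k).ae_iff (p := fun x => 0 ≤ x) (by fun_prop)).2 (ae_nonneg_expMeasure hμ)
  have hδ : ∀ᵐ ω ∂P, ∀ k, 0 ≤ δ k ω := ae_all_iff.2 fun k =>
    ((hsys.law_δ k).ae_iff (p := fun x => 0 ≤ x) (by fun_prop)).2 (ae_nonneg_expMeasure hμ)
  filter_upwards [hα, hδ] with ω h1 h2
  refine monotone_nat_of_le_succ fun k => ?_
  simp only [state]
  refine max_le_max ?_ ?_
  · exact le_max_of_le_left (le_add_of_nonneg_right (h1 k))
  · exact le_max_of_le_right (le_add_of_nonneg_right (h2 k))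

variable [IsProbabilityMeasure P]

lemma IsExponentialSystem.memLp_incrementBound (hsys : IsExponentialSystem P μ ν ν μ α β γ δ)
    (hμ : 0 < μ) (hν : 0 < ν) (n : ℕ) :
    MemLp (fun ω => incrementBound μ ν (matrixAt α β γ δ n ω)) 2 P := by
  have hl := hsys.hasLaw_matrixAt n
  have h := MaxPlus.memLp_incrementBound hμ hν
  rw [← hl.map_eq] at h
  exact (memLp_map_measure_iff h.aestronglyMeasurable hl.aemeasurable).1 h

lemma IsExponentialSystem.memLp_centredIncrement (hsys : IsExponentialSystem P μ ν ν μ α β γ δ)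
    (hμ : 0 < μ) (hν : 0 < ν) (n : ℕ) : MemLp (centredIncrement μ ν α β γ δ n) 2 P := by
  refine (hsys.memLp_incrementBound hμ hν n).mono' ?_
    (ae_of_all _ fun ω => abs_increment_le hμ hν _ _)
  exact ((measurable_increment μ ν).comp_aemeasurable
    (hsys.hasLaw_state_matrixAt n).aemeasurable).aestronglyMeasurable

lemma IsExponentialSystem.memLp_centred (hsys : IsExponentialSystem P μ ν ν μ α β γ δ)
    (hμ : 0 < μ) (hν : 0 < ν) (n : ℕ) : MemLp (centred μ ν α β γ δ n) 2 P := by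
  induction n with
  | zero =>
    exact memLp_const (potential μ ν 0 0 - (0 : ℕ) * (numP μ ν / denQ μ ν))
  | succ n ih =>
    rw [centred_succ]
    exact ih.add (hsys.memLp_centredIncrement hμ hν n)

/-- Martingale orthogonality: for a frozen state the first factor is constant and the increment has
mean zero by the Poisson equation. -/
lemma IsExponentialSystem.integral_centred_mul_centredIncrement
    (hsys : IsExponentialSystem P μ ν ν μ α β γ δ) (hμ : 0 < μ) (hν : 0 < ν) (n : ℕ) :
    ∫ ω, centred μ ν α β γ δ n ω * centredIncrement μ ν α β γ δ n ω ∂P = 0 := by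
  have := isProbabilityMeasure_matrixLaw hμ hν
  have hl := hsys.hasLaw_state_matrixAt n
  set f : (ℝ × ℝ) × ((ℝ × ℝ) × (ℝ × ℝ)) → ℝ := fun p =>
    (potential μ ν p.1.1 p.1.2 - n * (numP μ ν / denQ μ ν)) * increment μ ν p.1 p.2 with hf
  have mf : Measurable f :=
    (((measurable_potential μ ν).comp measurable_fst).sub_const _).mul (measurable_increment μ ν)
  have hi : Integrable (fun ω => f (state α β γ δ n ω, matrixAt α β γ δ n ω)) P :=
    (hsys.memLp_centred hμ hν n).integrable_mul (hsys.memLp_centredIncrement hμ hν n)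
  have hi' : Integrable f ((P.map (state α β γ δ n)).prod (matrixLaw μ ν)) := by
    rw [← hl.map_eq]
    exact (integrable_map_measure mf.aestronglyMeasurable hl.aemeasurable).2 hi
  refine (hl.integral_comp mf.aestronglyMeasurable).trans ?_
  rw [integral_prod _ hi']
  simp only [hf, integral_const_mul, integral_increment hμ hν, mul_zero, integral_zero]

/-- The cross term vanishes, so each step adds only the second moment of an increment, bounded
uniformly in the state. -/
lemma IsExponentialSystem.integral_centred_sq_le (hsys : IsExponentialSystem P μ ν ν μ α β γ δ)
    (hμ : 0 < μ) (hν : 0 < ν) (n : ℕ) :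
    ∫ ω, centred μ ν α β γ δ n ω ^ 2 ∂P
      ≤ (potential μ ν 0 0 ^ 2 + ∫ w, incrementBound μ ν w ^ 2 ∂matrixLaw μ ν) * (n + 1) := by
  have hK : 0 ≤ ∫ w, incrementBound μ ν w ^ 2 ∂matrixLaw μ ν :=
    integral_nonneg fun w => sq_nonneg _
  have key (n : ℕ) : ∫ ω, centred μ ν α β γ δ n ω ^ 2 ∂P
      ≤ potential μ ν 0 0 ^ 2 + n * ∫ w, incrementBound μ ν w ^ 2 ∂matrixLaw μ ν := by
    induction n with
    | zero => simp [centred, state]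
    | succ n ih =>
      have hM := hsys.memLp_centred hμ hν n
      have hξ := hsys.memLp_centredIncrement hμ hν n
      have hb := hsys.memLp_incrementBound hμ hν n
      have hMξ : Integrable
          (fun ω => centred μ ν α β γ δ n ω * centredIncrement μ ν α β γ δ n ω) P :=
        hM.integrable_mul hξ
      have hsq : ∫ ω, centredIncrement μ ν α β γ δ n ω ^ 2 ∂P
          ≤ ∫ w, incrementBound μ ν w ^ 2 ∂matrixLaw μ ν := by
        refine (integral_mono hξ.integrable_sq hb.integrable_sq fun ω => ?_).trans_eq
          ((hsys.hasLaw_matrixAt n).integral_comp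
            (MaxPlus.memLp_incrementBound hμ hν).integrable_sq.aestronglyMeasurable)
        exact sq_le_sq' (abs_le.1 (abs_increment_le hμ hν _ _)).1
          (abs_le.1 (abs_increment_le hμ hν _ _)).2
      have hexp : ∫ ω, centred μ ν α β γ δ (n + 1) ω ^ 2 ∂P
          = ∫ ω, centred μ ν α β γ δ n ω ^ 2 ∂P
            + 2 * ∫ ω, centred μ ν α β γ δ n ω * centredIncrement μ ν α β γ δ n ω ∂P
            + ∫ ω, centredIncrement μ ν α β γ δ n ω ^ 2 ∂P := by
        have hadd : Integrable (fun ω => centred μ ν α β γ δ n ω ^ 2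
            + 2 * (centred μ ν α β γ δ n ω * centredIncrement μ ν α β γ δ n ω)) P :=
          hM.integrable_sq.add (hMξ.const_mul 2)
        rw [← integral_const_mul, ← integral_add hM.integrable_sq (hMξ.const_mul 2),
          ← integral_add hadd hξ.integrable_sq]
        refine integral_congr_ae (ae_of_all _ fun ω => ?_)
        simp only [centred_succ]
        ring
      rw [hexp, hsys.integral_centred_mul_centredIncrement hμ hν n]
      push_cast
      linarith
  refine (key n).trans ?_
  have hn : (0 : ℝ) ≤ n := n.cast_nonneg
  have h0 := mul_nonneg hn (sq_nonneg (potential μ ν 0 0))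
  linarith

theorem IsExponentialSystem.isLyapunovExponent (hsys : IsExponentialSystem P μ ν ν μ α β γ δ)
    (hμ : 0 < μ) (hν : 0 < ν) : IsLyapunovExponent P α β γ δ (numP μ ν / denQ μ ν) := by
  filter_upwards [hsys.ae_monotone_max hμ, ae_tendsto_div_sq (hsys.memLp_centred hμ hν)
    (hsys.integral_centred_sq_le hμ hν)] with ω hmono hlim
  refine tendsto_one_div_mul_of_monotone hmono ?_
  set r : ℕ → ℝ := fun n => |(state α β γ δ n ω).1 - (state α β γ δ n ω).2| with hr
  have hsq : Tendsto (fun n : ℕ => (((n + 1) ^ 2 : ℕ) : ℝ)) atTop atTop := by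
    refine tendsto_natCast_atTop_atTop.comp (tendsto_atTop_mono (fun n => ?_) tendsto_id)
    simp only [id]
    nlinarith
  -- Boundedness of the corrector makes it negligible after division, so no control of the gap |x −
  -- y| is needed.
  have hcorr : Tendsto (fun n : ℕ => corrector μ ν (r ((n + 1) ^ 2)) / (((n + 1) ^ 2 : ℕ) : ℝ))
      atTop (𝓝 0) := by
    refine squeeze_zero_norm (fun n => ?_) (hsq.const_div_atTop (corrBound μ ν))
    rw [norm_div, Real.norm_eq_abs, RCLike.norm_natCast]
    gcongr
    exact abs_corrector_le hμ hν _ (abs_nonneg _)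
  have h := (hlim.sub hcorr).add_const (numP μ ν / denQ μ ν)
  rw [sub_zero, zero_add] at h
  refine h.congr fun n => ?_
  have hpos : (((n + 1) ^ 2 : ℕ) : ℝ) ≠ 0 := by positivity
  unfold centred potential
  field_simp
  ring

end LawOfLargeNumbers

end MaxPlus

theorem mainTheorem2 {Ω : Type*} [MeasurableSpace Ω] (P : Measure Ω) [IsProbabilityMeasure P]
    (μ ν σ τ : ℝ) (hμ : 0 < μ) (hν : 0 < ν) (hτ : τ = μ) (hσ : σ = ν)
    (α β γ δ : ℕ → Ω → ℝ) (hsys : MaxPlus.IsExponentialSystem P μ ν σ τ α β γ δ) :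
    MaxPlus.IsLyapunovExponent P α β γ δ (MaxPlus.numP μ ν / MaxPlus.denQ μ ν) := by
  subst hτ hσ
  exact hsys.isLyapunovExponent hμ hν
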